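/- Let $\phi:\mathbb{R}^3\to\mathbb{R}$ be a polynomial function with $\phi(0)=0$, $\nabla\phi(0)=0$ and $\det(D^2\phi(x))=0$ for all $x\in\mathbb{R}^3$. By a local analytic change of coordinates we mean a bijection $x=F(y)$ between open neighbourhoods of the origin in $\mathbb{R}^3$ with $F(0)=0$ such that $F$ and $F^{-1}$ are real-analytic. (a) There are a local analytic change of coordinates $x=F(y)$ and a function $g$ of two real variables, analytic at the origin, such that $\phi(F(y))=g(y_1,y_2)$ for all $y$ in the domain of $F$. That is, after a local analytic change of coordinates $\phi$ depends on at most two variables. (b) Suppose that $A\in\mathbb{R}^{3\times3}$ is invertible and that $$\phi(Ax)=Q_1(x_1)+Q_2(x_1)x_2+Q_3(x_1)x_3\qquad(x\in\mathbb{R}^3)$$ with polynomials $Q_1,Q_2,Q_3:\mathbb{R}\to\mathbb{R}$. Let $\nu_j\in\mathbb{N}\cup\{0,\infty\}$ be the multiplicity of $0$ as a root of $Q_j$, with $\nu_j=\infty$ if $Q_j\equiv0$. - If $\nu_1<\infty$, $\nu_1\le\nu_2$ and $\nu_1\le\nu_3$, then there is a local analytic change of coordinates $x=F(y)$ with $\phi(AF(y))=\sigma\,y_1^{\nu_1}$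 on the domain of $F$, where $\sigma\in\{1,-1\}$ is the sign of the coefficient of $t^{\nu_1}$ in $Q_1(t)$. - If $\nu_2<\infty$, $\nu_2<\nu_1$ and $\nu_2\le\nu_3$, then there is a local analytic change of coordinates $x=F(y)$ with $\phi(AF(y))=y_1^{\nu_2}y_2$ on the domain of $F$. (The only remaining case with $\phi\not\equiv0$, namely $\nu_3<\nu_1$ and $\nu_3<\nu_2$, is reduced to the second one by exchanging $x_2$ and $x_3$.) -/

import Mathlib

/-- The Hessian matrix `D²φ` of a polynomial `φ` in three real variables, as a matrix of
polynomials. -/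
noncomputable def hessianMatrix (φ : MvPolynomial (Fin 3) ℝ) :
    Matrix (Fin 3) (Fin 3) (MvPolynomial (Fin 3) ℝ) :=
  Matrix.of fun i j => MvPolynomial.pderiv i (MvPolynomial.pderiv j φ)

/-- `x = e y` is a local analytic change of coordinates at the origin of `ℝ³`: a homeomorphism
between two open neighbourhoods of the origin which fixes the origin and is real-analytic
together with its inverse. -/
structure IsLocalAnalyticChange (e : OpenPartialHomeomorph (Fin 3 → ℝ) (Fin 3 → ℝ)) : Prop where
  zero_mem : (0 : Fin 3 → ℝ) ∈ e.source
  map_zero : e 0 = 0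
  analytic : AnalyticOnNhd ℝ e e.source
  analytic_symm : AnalyticOnNhd ℝ e.symm e.target

/-! The heart is a Gordan–Noether type argument. A singular Hessian makes the partial derivatives of
`f` algebraically dependent. If `P` is a relation of least degree, the vector `(∂ᵢP)(∇f)` is nonzero
and lies in the kernel of the Hessian. Its derivation kills every `∂ᵢf`, hence its own components,
which are polynomials in them. Divided by the gcd this gives a coprime field `V` that is constant
along each line `x + tV(x)` (`exists_kernel_field`).

In three variables such a field satisfies a constant linear relation (`exists_linear_relation`):
lines that meet must carry the same value of `V`, and coprimality forbids `V` to vanish on a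
surface. After a linear change `V 0 = 0`, and `V` depends on `x 0` only. Either `V` is constant, and
`f` is constant in that direction because its gradient vanishes at `0`, or `f` is affine in the
other two variables (`constant_or_affine_of_plane`).

In the affine case the lowest power of `x 0` is factored out. The cofactor is absorbed into a
coordinate through a root, or is itself taken as a coordinate, by the analytic inverse function
theorem (`exists_change_pow`, `exists_change_pow_mul`). -/

open MvPolynomial in
/-- The substitution `xᵢ ↦ xᵢ + t Vᵢ`. -/
noncomputable def alongLine {σ k : Type*} [Field k] (V : σ → MvPolynomial σ k) :
    MvPolynomial σ k →ₐ[k] Polynomial (MvPolynomial σ k) :=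
  aeval fun i => Polynomial.C (X i) + Polynomial.C (V i) * Polynomial.X

/-! ### Restriction of polynomials to the lines of a field -/

section AlongLine

open MvPolynomial

variable {σ k : Type*} [Field k] {V : σ → MvPolynomial σ k}

theorem alongLine_X (V : σ → MvPolynomial σ k) (i : σ) :
    alongLine V (X i) = Polynomial.C (X i) + Polynomial.C (V i) * Polynomial.X := by
  simp [alongLine]

theorem coeff_zero_alongLine (V : σ → MvPolynomial σ k) (p : MvPolynomial σ k) :
    (alongLine V p).coeff 0 = p := by
  induction p using MvPolynomial.induction_on with
  | C a => simp
  | add p q hp hq => simp [hp, hq]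
  | mul_X p i hp => simp [Polynomial.mul_coeff_zero, alongLine_X, hp]

/-- Taylor's formula: since the direction is itself killed by the derivation `D`, the coefficient of
`t ^ n` in `p (x + tV)` is `Dⁿp / n!`. -/
theorem coeff_succ_alongLine (hV : ∀ i, mkDerivation k V (V i) = 0) (p : MvPolynomial σ k) (n : ℕ) :
    ((n : MvPolynomial σ k) + 1) * (alongLine V p).coeff (n + 1) =
      mkDerivation k V ((alongLine V p).coeff n) := by
  induction p using MvPolynomial.induction_on generalizing n with
  | C a => cases n <;> simp [Polynomial.coeff_C]
  | add p q hp hq => simp [mul_add, hp, hq]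
  | mul_X p i hp =>
    have key : ∀ n, (alongLine V (p * X i)).coeff (n + 1) =
        (alongLine V p).coeff (n + 1) * X i + (alongLine V p).coeff n * V i := fun n => by
      rw [map_mul, alongLine_X, mul_add, ← mul_assoc, Polynomial.coeff_add,
        Polynomial.coeff_mul_C, Polynomial.coeff_mul_X, Polynomial.coeff_mul_C]
    cases n with
    | zero =>
      have h0 := hp 0
      rw [key, coeff_zero_alongLine, coeff_zero_alongLine]
      rw [coeff_zero_alongLine] at h0
      simp only [Derivation.leibniz, smul_eq_mul, mkDerivation_X, ← h0]
      push_cast; ring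
    | succ n =>
      have h0 := hp n
      have h1 := hp (n + 1)
      rw [key, key]
      simp only [map_add, Derivation.leibniz, smul_eq_mul, mkDerivation_X, hV, ← h0, ← h1]
      push_cast; ring

variable [CharZero k]

theorem alongLine_eq_C (hV : ∀ i, mkDerivation k V (V i) = 0) {p : MvPolynomial σ k}
    (hp : mkDerivation k V p = 0) : alongLine V p = Polynomial.C p := by
  have h : ∀ n, (alongLine V p).coeff (n + 1) = 0 := by
    intro n
    have hn : ((n : MvPolynomial σ k) + 1) ≠ 0 := by exact_mod_cast n.succ_ne_zero
    induction n with
    | zero =>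
      have := coeff_succ_alongLine hV p 0
      rw [coeff_zero_alongLine, hp] at this
      exact (mul_eq_zero.mp this).resolve_left hn
    | succ n ih =>
      have := coeff_succ_alongLine hV p (n + 1)
      rw [ih (by exact_mod_cast n.succ_ne_zero), map_zero] at this
      exact (mul_eq_zero.mp this).resolve_left hn
  ext1 n
  cases n with
  | zero => simp [coeff_zero_alongLine]
  | succ n => simp [h]

theorem alongLine_eq_of_derivation_derivation (hV : ∀ i, mkDerivation k V (V i) = 0)
    {p : MvPolynomial σ k} (hp : mkDerivation k V (mkDerivation k V p) = 0) :
    alongLine V p = Polynomial.C p + Polynomial.C (mkDerivation k V p) * Polynomial.X := by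
  have h1 : (alongLine V p).coeff 1 = mkDerivation k V p := by
    simpa [coeff_zero_alongLine] using coeff_succ_alongLine hV p 0
  have h : ∀ n, (alongLine V p).coeff (n + 2) = 0 := by
    intro n
    have hn : (((n + 1 : ℕ) : MvPolynomial σ k) + 1) ≠ 0 := by exact_mod_cast (n + 1).succ_ne_zero
    induction n with
    | zero =>
      have := coeff_succ_alongLine hV p 1
      rw [h1, hp] at this
      exact (mul_eq_zero.mp this).resolve_left hn
    | succ n ih =>
      have := coeff_succ_alongLine hV p (n + 2)
      rw [ih (by exact_mod_cast (n + 1).succ_ne_zero), map_zero] at this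
      exact (mul_eq_zero.mp this).resolve_left hn
  ext1 n
  rcases n with _ | _ | n
  · simp [coeff_zero_alongLine]
  · simp [h1, Polynomial.coeff_C]
  · simp [h]

/-- Degrees in `t` add over a domain, so a product that is constant along the lines has constant
factors. -/
theorem derivation_eq_zero_of_mul (hV : ∀ i, mkDerivation k V (V i) = 0) {p q : MvPolynomial σ k}
    (hpq : p * q ≠ 0) (h : mkDerivation k V (p * q) = 0) : mkDerivation k V p = 0 := by
  have h1 := alongLine_eq_C hV h
  rw [map_mul] at h1
  have hne : alongLine V p * alongLine V q ≠ 0 := by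
    rw [h1]; simpa using hpq
  have hdeg := congrArg Polynomial.natDegree h1
  rw [Polynomial.natDegree_mul (left_ne_zero_of_mul hne) (right_ne_zero_of_mul hne),
    Polynomial.natDegree_C] at hdeg
  have := coeff_succ_alongLine hV p 0
  rw [coeff_zero_alongLine, Polynomial.coeff_eq_zero_of_natDegree_lt (by omega), mul_zero] at this
  exact this.symm

theorem derivation_eq_zero_of_dvd (hV : ∀ i, mkDerivation k V (V i) = 0) {p q : MvPolynomial σ k}
    (hq : q ≠ 0) (hpq : p ∣ q) (h : mkDerivation k V q = 0) : mkDerivation k V p = 0 := by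
  obtain ⟨r, rfl⟩ := hpq
  exact derivation_eq_zero_of_mul hV hq h

/-- A derivation in the direction of a straight-line field has no proper eigenvectors. -/
theorem derivation_eq_zero_of_self_dvd (hV : ∀ i, mkDerivation k V (V i) = 0)
    {p : MvPolynomial σ k} (h : p ∣ mkDerivation k V p) : mkDerivation k V p = 0 := by
  by_cases hp : p = 0
  · simp [hp]
  have hd : ∀ n, p ∣ (alongLine V p).coeff n := by
    intro n
    induction n with
    | zero => rw [coeff_zero_alongLine]
    | succ n ih =>
      obtain ⟨q, hq⟩ := ih
      have h1 := coeff_succ_alongLine hV p n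
      have hu : IsUnit ((n : MvPolynomial σ k) + 1) := by
        have : ((n : MvPolynomial σ k) + 1) = C ((n : k) + 1) := by simp
        rw [this]
        exact (IsUnit.mk0 _ (by exact_mod_cast n.succ_ne_zero)).map C
      rw [← hu.dvd_mul_left, h1, hq, Derivation.leibniz]
      exact dvd_add (Dvd.intro _ rfl) (by simpa using h.mul_left q)
  have hne : alongLine V p ≠ 0 := fun h0 => hp (by rw [← coeff_zero_alongLine V p, h0]; simp)
  -- The leading coefficient in `t` is nonzero, divisible by `p`, and killed because the next
  -- coefficient is zero.
  refine derivation_eq_zero_of_dvd hV (Polynomial.leadingCoeff_ne_zero.mpr hne) (hd _) ?_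
  rw [Polynomial.leadingCoeff, ← coeff_succ_alongLine hV,
    Polynomial.coeff_eq_zero_of_natDegree_lt (Nat.lt_succ_self _), mul_zero]

end AlongLine

/-! ### Algebraic dependence of the derivatives and the kernel field -/

section Relation

open MvPolynomial

variable {σ k : Type*} [Field k]

theorem pderiv_pderiv_comm (i j : σ) (p : MvPolynomial σ k) :
    pderiv i (pderiv j p) = pderiv j (pderiv i p) := by
  classical
  have h : ⁅pderiv (R := k) (σ := σ) i, pderiv (R := k) (σ := σ) j⁆ = 0 := by
    refine derivation_ext fun l => ?_
    rw [Derivation.commutator_apply]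
    simp only [pderiv_X, Derivation.coe_zero, Pi.zero_apply, Pi.single_apply]
    split_ifs <;> simp
  have := congrArg (fun D => D p) h
  simpa [Derivation.commutator_apply, sub_eq_zero] using this

theorem derivation_aeval [Fintype σ] {A : Type*} [CommRing A] [Algebra k A] (D : Derivation k A A)
    (F : σ → A) (P : MvPolynomial σ k) :
    D (aeval F P) = ∑ j, aeval F (pderiv j P) * D (F j) := by
  classical
  induction P using MvPolynomial.induction_on with
  | C a => simp
  | add p q hp hq => simp [add_mul, Finset.sum_add_distrib, hp, hq]
  | mul_X p i hp =>
    simp only [map_mul, aeval_X, Derivation.leibniz, smul_eq_mul, hp, pderiv_X, map_add, add_mul,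
      Finset.sum_add_distrib, Pi.single_apply, Finset.mul_sum]
    congr 1
    · simp
    · exact Finset.sum_congr rfl fun j _ => by ring

theorem mkDerivation_eq_sum_pderiv [Fintype σ] (V : σ → MvPolynomial σ k) (p : MvPolynomial σ k) :
    mkDerivation k V p = ∑ i, V i * pderiv i p := by
  have h := derivation_aeval (mkDerivation k V) X p
  simp only [aeval_X_left, AlgHom.id_apply, mkDerivation_X] at h
  rw [h]
  exact Finset.sum_congr rfl fun i _ => mul_comm _ _

theorem totalDegree_pderiv_lt {i : σ} {p : MvPolynomial σ k} (h : pderiv i p ≠ 0) :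
    (pderiv i p).totalDegree < p.totalDegree := by
  obtain ⟨m, hm, hdeg⟩ : ∃ m ∈ (pderiv i p).support, (pderiv i p).totalDegree = m.degree := by
    obtain ⟨m, hm, h1⟩ := Finset.exists_mem_eq_sup _ (support_nonempty.mpr h) Finsupp.degree
    exact ⟨m, hm, by rw [← h1]; rfl⟩
  rw [mem_support_iff, coeff_pderiv] at hm
  have := le_totalDegree (mem_support_iff.mpr (left_ne_zero_of_mul hm))
  change (m + Finsupp.single i 1).degree ≤ _ at this
  rw [map_add, Finsupp.degree_single] at this
  omega

variable [CharZero k]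

theorem eq_C_of_pderiv_eq_zero {p : MvPolynomial σ k} (h : ∀ i, pderiv i p = 0) :
    p = C (p.coeff 0) := by
  classical
  ext m
  rw [coeff_C]
  split_ifs with hm
  · rw [← hm]
  · obtain ⟨i, hi⟩ : ∃ i, m i ≠ 0 := by
      by_contra! h0
      exact hm (Finsupp.ext fun i => (h0 i).symm)
    have h1 := coeff_pderiv (i := i) p (m - Finsupp.single i 1)
    have h2 : m - Finsupp.single i 1 + Finsupp.single i 1 = m :=
      tsub_add_cancel_of_le (Finsupp.single_le_iff.mpr (Nat.one_le_iff_ne_zero.mpr hi))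
    rw [h i, h2, coeff_zero, eq_comm, mul_eq_zero] at h1
    exact h1.resolve_right (Nat.cast_add_one_ne_zero _)

/-- Apply `D` to an equation `q(x) = 0` of least degree: `q'(x) * D x = 0`, and `q'(x) ≠ 0` by
minimality in characteristic zero. -/
theorem derivation_eq_zero_of_isAlgebraic {A : Type*} [CommRing A] [IsDomain A] [Algebra k A]
    (D : Derivation k A A) (S : Subalgebra k A) (hS : ∀ s ∈ S, D s = 0) {x : A}
    (hx : IsAlgebraic S x) : D x = 0 := by
  classical
  have chain : ∀ q : Polynomial S, D (Polynomial.aeval x q) =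
      Polynomial.aeval x (Polynomial.derivative q) * D x := by
    intro q
    induction q using Polynomial.induction_on' with
    | add p q hp hq => simp [add_mul, hp, hq]
    | monomial n a =>
      simp only [Polynomial.aeval_monomial, Polynomial.derivative_monomial, Derivation.leibniz,
        smul_eq_mul, Derivation.leibniz_pow, map_mul, nsmul_eq_mul]
      have hn : (algebraMap S A) (n : S) = n := map_natCast _ n
      rw [show D (algebraMap S A a) = 0 from hS _ a.2]
      linear_combination (-(algebraMap S A) a * x ^ (n - 1) * D x) * hn
  obtain ⟨q, ⟨hq0, hq⟩, hmin⟩ := WellFounded.has_min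
    (InvImage.wf (fun q : Polynomial S => q.natDegree) Nat.lt_wfRel.wf)
    {q : Polynomial S | q ≠ 0 ∧ Polynomial.aeval x q = 0} hx
  have h1 := chain q
  rw [hq, map_zero] at h1
  refine (mul_eq_zero.mp h1.symm).resolve_left fun h2 => ?_
  have hinj := FaithfulSMul.algebraMap_injective S A
  have : CharZero A := charZero_of_injective_algebraMap (algebraMap k A).injective
  have : CharZero S := charZero_of_injective_algebraMap (algebraMap k S).injective
  have hdeg : q.natDegree ≠ 0 := fun h0 => by
    rw [Polynomial.eq_C_of_natDegree_eq_zero h0, Polynomial.aeval_C] at hq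
    apply hq0
    rw [Polynomial.eq_C_of_natDegree_eq_zero h0, (map_eq_zero_iff _ hinj).mp hq, map_zero]
  have hne : Polynomial.derivative q ≠ 0 := fun h0 =>
    hdeg (Polynomial.derivative_eq_zero.mp h0)
  exact hmin _ ⟨hne, h2⟩ (Polynomial.natDegree_derivative_lt hdeg)

/-- Polynomials with vanishing Jacobian determinant are algebraically dependent. -/
theorem not_algebraicIndependent_of_det_eq_zero [Fintype σ] [DecidableEq σ]
    (F : σ → MvPolynomial σ k) (hF : (Matrix.of fun i j => pderiv j (F i)).det = 0) :
    ¬ AlgebraicIndependent k F := by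
  intro hind
  obtain ⟨W, hW, hFW⟩ := Matrix.exists_mulVec_eq_zero_iff.mpr hF
  have hzero : ∀ i, mkDerivation k W (F i) = 0 := fun i => by
    refine Eq.trans ?_ (congrFun hFW i)
    rw [mkDerivation_eq_sum_pderiv, Matrix.mulVec, dotProduct]
    exact Finset.sum_congr rfl fun j _ => mul_comm _ _
  -- There are as many `F i` as variables, so every variable is algebraic over them and is killed by
  -- the derivation along `W`; this forces `W = 0`.
  have hbasis : IsTranscendenceBasis k F :=
    hind.isTranscendenceBasis_of_lift_trdeg_le_of_finite (by simp)
  have := hbasis.isAlgebraic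
  apply hW
  funext i
  rw [Pi.zero_apply, ← mkDerivation_X (R := k) W i]
  refine derivation_eq_zero_of_isAlgebraic _ (Algebra.adjoin k (Set.range F)) (fun s hs => ?_)
    (Algebra.IsAlgebraic.isAlgebraic (X i : MvPolynomial σ k))
  induction hs using Algebra.adjoin_induction with
  | mem x hx => obtain ⟨i, rfl⟩ := hx; exact hzero i
  | algebraMap r => exact Derivation.map_algebraMap _ r
  | add x y _ _ hx hy => rw [map_add, hx, hy, add_zero]
  | mul x y _ _ hx hy => rw [Derivation.leibniz, hx, hy, smul_zero, smul_zero, add_zero]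

/-- A polynomial with singular Hessian has a field of kernel directions with coprime components,
constant along its own integral lines. -/
theorem exists_kernel_field [Fintype σ] [DecidableEq σ] (f : MvPolynomial σ k)
    (hf : (Matrix.of fun i j => pderiv i (pderiv j f)).det = 0) :
    ∃ V : σ → MvPolynomial σ k, (∀ q, (∀ i, q ∣ V i) → IsUnit q) ∧
      (∀ i, mkDerivation k V (V i) = 0) ∧ ∀ i, mkDerivation k V (pderiv i f) = 0 := by
  have hdep := not_algebraicIndependent_of_det_eq_zero (fun i => pderiv i f) (by
    simpa only [pderiv_pderiv_comm] using hf)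
  rw [algebraicIndependent_iff] at hdep
  push Not at hdep
  obtain ⟨P, ⟨hP, hP0⟩, hmin⟩ := WellFounded.has_min
    (InvImage.wf (fun q : MvPolynomial σ k => q.totalDegree) Nat.lt_wfRel.wf)
    {q | aeval (fun i => pderiv i f) q = 0 ∧ q ≠ 0} hdep
  obtain ⟨i₀, hi₀⟩ : ∃ i, pderiv i P ≠ 0 := by
    by_contra! h
    rw [eq_C_of_pderiv_eq_zero h] at hP hP0
    rw [aeval_C, algebraMap_eq] at hP
    exact hP0 hP
  obtain ⟨U, hU⟩ : ∃ U : σ → MvPolynomial σ k,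
      U = fun i => aeval (fun i => pderiv i f) (pderiv i P) := ⟨_, rfl⟩
  have hU0 : U i₀ ≠ 0 := fun h =>
    hmin _ ⟨by rw [hU] at h; exact h, hi₀⟩ (totalDegree_pderiv_lt hi₀)
  -- Differentiate the relation `P(∇f) = 0` with respect to the `i`-th variable.
  have hUf : ∀ i, mkDerivation k U (pderiv i f) = 0 := fun i => by
    have h := derivation_aeval (pderiv i) (fun i => pderiv i f) P
    rw [hP, map_zero] at h
    rw [mkDerivation_eq_sum_pderiv, h, hU]
    exact Finset.sum_congr rfl fun j _ => by rw [pderiv_pderiv_comm i j]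
  have hUU : ∀ i, mkDerivation k U (U i) = 0 := fun i => by
    conv_lhs => rw [show U i = aeval (fun i => pderiv i f) (pderiv i P) by rw [hU]]
    rw [derivation_aeval]
    simp [hUf]
  obtain ⟨inst⟩ : Nonempty (NormalizedGCDMonoid (MvPolynomial σ k)) := inferInstance
  obtain ⟨V, hV, hgcd⟩ := Finset.extract_gcd U (s := Finset.univ) ⟨i₀, Finset.mem_univ _⟩
  set g := Finset.univ.gcd U
  have hg : g ≠ 0 := fun h => hU0 (by rw [hV i₀ (Finset.mem_univ _), h, zero_mul])
  have hUV : ∀ p, mkDerivation k U p = g * mkDerivation k V p := fun p => by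
    rw [mkDerivation_eq_sum_pderiv, mkDerivation_eq_sum_pderiv, Finset.mul_sum]
    exact Finset.sum_congr rfl fun i hi => by rw [hV i hi, mul_assoc]
  have hz : ∀ {p}, mkDerivation k U p = 0 → mkDerivation k V p = 0 := fun {p} h => by
    rw [hUV] at h
    exact (mul_eq_zero.mp h).resolve_left hg
  refine ⟨V, fun q hq => ?_, fun i => hz ?_, fun i => hz (hUf i)⟩
  · exact isUnit_of_dvd_one (hgcd ▸ Finset.dvd_gcd fun i _ => hq i)
  · by_cases h : U i = 0
    · have : V i = 0 := by
        rw [hV i (Finset.mem_univ _)] at h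
        exact (mul_eq_zero.mp h).resolve_left hg
      rw [this, map_zero]
    · exact derivation_eq_zero_of_dvd hUU h ⟨g, by rw [hV i (Finset.mem_univ _), mul_comm]⟩ (hUU i)

end Relation

/-! ### Lines of a field that meet -/

section Lines

open MvPolynomial

/-- The target is a general ring so that lines can also be drawn through generic points of
hypersurfaces. -/
theorem eval₂_alongLine {σ k K : Type*} [Field k] [CommRing K] (V : σ → MvPolynomial σ k)
    (ψ : MvPolynomial σ k →+* K) (t : K) (p : MvPolynomial σ k) :
    (alongLine V p).eval₂ ψ t = eval₂ (ψ.comp C) (fun i => ψ (X i) + ψ (V i) * t) p := by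
  induction p using MvPolynomial.induction_on with
  | C a => simp
  | add p q hp hq => rw [map_add, Polynomial.eval₂_add, hp, hq, eval₂_add]
  | mul_X p i hp =>
    rw [map_mul, Polynomial.eval₂_mul, hp, eval₂_mul, alongLine_X, eval₂_X]
    simp

theorem eval₂_eval_alongLine {σ : Type*} (V : σ → MvPolynomial σ ℝ) (x : σ → ℝ) (t : ℝ)
    (p : MvPolynomial σ ℝ) :
    (alongLine V p).eval₂ (eval x) t = eval (fun i => x i + t * eval x (V i)) p := by
  rw [eval₂_alongLine]
  have : (eval x).comp C = RingHom.id ℝ := by ext; simp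
  simp only [this, eval_X, mul_comm t]
  rfl

theorem eval_add_smul {σ : Type*} {V : σ → MvPolynomial σ ℝ} (hV : ∀ i, mkDerivation ℝ V (V i) = 0)
    {p : MvPolynomial σ ℝ} (hp : mkDerivation ℝ V (mkDerivation ℝ V p) = 0) (x : σ → ℝ) (t : ℝ) :
    eval (fun i => x i + t * eval x (V i)) p = eval x p + t * eval x (mkDerivation ℝ V p) := by
  rw [← eval₂_eval_alongLine, alongLine_eq_of_derivation_derivation hV hp]
  simp only [Polynomial.eval₂_add, Polynomial.eval₂_mul, Polynomial.eval₂_C, Polynomial.eval₂_X,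
    mul_comm t]

theorem mkDerivation_single {σ : Type*} [DecidableEq σ] (j : σ) :
    mkDerivation ℝ (Pi.single j 1 : σ → MvPolynomial σ ℝ) = pderiv j := by
  rw [pderiv_def]

theorem mkDerivation_single_single {σ : Type*} [DecidableEq σ] (j i : σ) :
    mkDerivation ℝ (Pi.single j 1 : σ → MvPolynomial σ ℝ)
      ((Pi.single j 1 : σ → MvPolynomial σ ℝ) i) = 0 := by
  rw [Pi.single_apply]
  split_ifs <;> simp

theorem add_mul_eval_single {σ : Type*} [DecidableEq σ] (j : σ) (x : σ → ℝ) (t : ℝ) :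
    (fun i => x i + t * eval x ((Pi.single j 1 : σ → MvPolynomial σ ℝ) i)) =
      Function.update x j (x j + t) := by
  funext i
  by_cases hi : i = j
  · subst hi; simp
  · simp [hi]

theorem eval_update_add {σ : Type*} [DecidableEq σ] {p : MvPolynomial σ ℝ} {j : σ}
    (hp : pderiv j (pderiv j p) = 0) (x : σ → ℝ) (t : ℝ) :
    eval (Function.update x j (x j + t)) p = eval x p + t * eval x (pderiv j p) := by
  have h := eval_add_smul (mkDerivation_single_single j) (p := p)
    (by rwa [mkDerivation_single]) x t
  rw [mkDerivation_single] at h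
  rwa [add_mul_eval_single] at h

theorem pderiv_eq_zero_of_self_dvd {σ : Type*} {p : MvPolynomial σ ℝ} {j : σ}
    (h : p ∣ pderiv j p) : pderiv j p = 0 := by
  classical
  rw [← mkDerivation_single] at h ⊢
  exact derivation_eq_zero_of_self_dvd (mkDerivation_single_single j) h

theorem pderiv_eq_zero_of_isUnit {σ : Type*} {p : MvPolynomial σ ℝ} (j : σ) (h : IsUnit p) :
    pderiv j p = 0 :=
  pderiv_eq_zero_of_self_dvd h.dvd

/-- The hypothesis is an identity of polynomials in `t`; its linear coefficient is the claim. -/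
theorem mul_pderiv_eq_of_eval {σ : Type*} [DecidableEq σ] {p q : MvPolynomial σ ℝ} {j : σ}
    (h : ∀ x t, eval x p * eval (Function.update x j (x j + t)) q =
      eval x q * eval (Function.update x j (x j + t)) p) :
    p * pderiv j q = q * pderiv j p := by
  have hc : ∀ r : MvPolynomial σ ℝ, (alongLine (Pi.single j 1 : σ → MvPolynomial σ ℝ) r).coeff 1 =
      pderiv j r := fun r => by
    have := coeff_succ_alongLine (mkDerivation_single_single j) r 0
    rwa [coeff_zero_alongLine, mkDerivation_single, Nat.cast_zero, zero_add, one_mul] at this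
  have he : ∀ (r : MvPolynomial σ ℝ) x t,
      ((alongLine (Pi.single j 1 : σ → MvPolynomial σ ℝ) r).map (eval x)).eval t =
        eval (Function.update x j (x j + t)) r := fun r x t => by
    rw [Polynomial.eval_map, eval₂_eval_alongLine, add_mul_eval_single]
  have hpoly : Polynomial.C p * alongLine (Pi.single j 1 : σ → MvPolynomial σ ℝ) q =
      Polynomial.C q * alongLine (Pi.single j 1 : σ → MvPolynomial σ ℝ) p := by
    refine Polynomial.ext fun n => MvPolynomial.funext fun x => ?_
    rw [← Polynomial.coeff_map, ← Polynomial.coeff_map]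
    refine congrArg (fun r => Polynomial.coeff r n) (Polynomial.funext fun t => ?_)
    rw [Polynomial.map_mul, Polynomial.map_mul, Polynomial.map_C, Polynomial.map_C,
      Polynomial.eval_mul, Polynomial.eval_mul, Polynomial.eval_C, Polynomial.eval_C, he, he]
    exact h x t
  have := congrArg (fun r => Polynomial.coeff r 1) hpoly
  rwa [Polynomial.coeff_C_mul, Polynomial.coeff_C_mul, hc, hc] at this

/-- Two non-parallel lines of a planar straight-line field would meet. -/
theorem eval_mul_eval_eq_of_plane {V : Fin 3 → MvPolynomial (Fin 3) ℝ} (h0 : V 0 = 0)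
    (hV : ∀ i, mkDerivation ℝ V (V i) = 0) {x y : Fin 3 → ℝ} (hxy : x 0 = y 0) :
    eval x (V 1) * eval y (V 2) = eval x (V 2) * eval y (V 1) := by
  by_contra hne
  have hd : eval x (V 1) * eval y (V 2) - eval x (V 2) * eval y (V 1) ≠ 0 := sub_ne_zero.mpr hne
  set d := eval x (V 1) * eval y (V 2) - eval x (V 2) * eval y (V 1) with hd'
  have hline : ∀ (i : Fin 3) (z : Fin 3 → ℝ) t,
      eval (fun i => z i + t * eval z (V i)) (V i) = eval z (V i) := fun i z t => by
    rw [eval_add_smul hV (by rw [hV, map_zero]), hV, map_zero, mul_zero, add_zero]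
  -- Cramer's rule gives the parameters of the intersection point.
  set t := ((y 1 - x 1) * eval y (V 2) - (y 2 - x 2) * eval y (V 1)) / d
  set u := ((y 1 - x 1) * eval x (V 2) - (y 2 - x 2) * eval x (V 1)) / d
  have hmeet : (fun i => x i + t * eval x (V i)) = fun i => y i + u * eval y (V i) := by
    funext i
    fin_cases i
    · simp [h0, hxy]
    · change x 1 + t * eval x (V 1) = y 1 + u * eval y (V 1)
      simp only [t, u]
      field_simp
      rw [hd']; ring
    · change x 2 + t * eval x (V 2) = y 2 + u * eval y (V 2)
      simp only [t, u]
      field_simp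
      rw [hd']; ring
  have hs : ∀ i, eval x (V i) = eval y (V i) := fun i => by
    rw [← hline i x t, hmeet, hline]
  apply hne
  rw [hs 1, hs 2, mul_comm]

/-- At a point of the hypersurface `L₁ V₂ = L₂ V₁`, where `Lᵢ` are the coordinates relative to a
point at which the field is vertical, the line of the field meets the vertical line, unless the
field is vertical there. -/
theorem map_eq_zero_of_meets {K : Type*} [Field K] (ψ : MvPolynomial (Fin 3) ℝ →+* K)
    {V : Fin 3 → MvPolynomial (Fin 3) ℝ} (hV : ∀ i, mkDerivation ℝ V (V i) = 0) (y : Fin 3 → ℝ)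
    {i j : Fin 3} (hij : ∀ m, m = 0 ∨ m = i ∨ m = j) (hi : eval y (V i) = 0) (hj : eval y (V j) = 0)
    (hy0 : eval y (V 0) = 1)
    (h : ψ (X i - C (y i)) * ψ (V j) = ψ (X j - C (y j)) * ψ (V i)) : ψ (V i) = 0 := by
  by_contra hne
  -- At parameter `t` the line through the point `ψ` has `i`-th coordinate `y i`, and by `h` also
  -- `j`-th coordinate `y j`; `s` is its height above `y`.
  set t := -ψ (X i - C (y i)) / ψ (V i) with ht
  set s := ψ (X 0) + ψ (V 0) * t - ψ (C (y 0)) with hs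
  -- The value of `V i` at the meeting point, computed along both lines: it is `ψ (V i)` on one and
  -- `V i` at `y`, that is `0`, on the other.
  have key : (alongLine V (V i)).eval₂ ψ t =
      (alongLine V (V i)).eval₂ ((ψ.comp C).comp (eval y)) s := by
    rw [eval₂_alongLine, eval₂_alongLine]
    congr 1
    · ext a; simp
    · funext m
      simp only [map_sub] at h ht
      rcases hij m with rfl | rfl | rfl
      · simp [hy0, hs]
      · simp [hi, ht]
        field_simp
        ring
      · simp [hj, ht]
        field_simp
        linear_combination -h
  rw [alongLine_eq_C hV (hV i), Polynomial.eval₂_C, Polynomial.eval₂_C] at key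
  apply hne
  rw [key, RingHom.comp_apply, hi, map_zero]

end Lines

/-! ### The linear relation for a field vertical at one point -/

section Field

open MvPolynomial

theorem exists_eval_ne_zero {σ : Type*} {p : MvPolynomial σ ℝ} (hp : p ≠ 0) :
    ∃ x, eval x p ≠ 0 := by
  by_contra! h
  exact hp (MvPolynomial.funext fun x => by rw [h, map_zero])

theorem pderiv_mul_eq {σ : Type*} (i : σ) (p q : MvPolynomial σ ℝ) :
    pderiv i (p * q) = pderiv i p * q + p * pderiv i q := pderiv_mul

/-- If a coprime straight-line field is vertical at some point, then its horizontal direction does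
not depend on the vertical coordinate. -/
theorem exists_horizontal_factors_of_vertical {V : Fin 3 → MvPolynomial (Fin 3) ℝ}
    (hcop : ∀ q, (∀ i, q ∣ V i) → IsUnit q) (hV : ∀ i, mkDerivation ℝ V (V i) = 0)
    {y : Fin 3 → ℝ} (hy0 : eval y (V 0) = 1) (hy1 : eval y (V 1) = 0) (hy2 : eval y (V 2) = 0)
    (hV1 : V 1 ≠ 0) :
    ∃ a b G, G * a = V 1 ∧ G * b = V 2 ∧ pderiv 0 a = 0 ∧ pderiv 0 b = 0 := by
  have hDX : ∀ i, mkDerivation ℝ V (X i - C (y i)) = V i := fun i => by simp [mkDerivation_X]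
  have hsum : ∀ p, mkDerivation ℝ V p = V 0 * pderiv 0 p + V 1 * pderiv 1 p + V 2 * pderiv 2 p :=
    fun p => by rw [mkDerivation_eq_sum_pderiv, Fin.sum_univ_three]
  obtain ⟨a, b, G, hab, hGa, hGb⟩ :=
    UniqueFactorizationMonoid.exists_reduced_factors (V 1) hV1 (V 2)
  have hG : G ≠ 0 := fun h => hV1 (by rw [← hGa, h, zero_mul])
  -- On `r = 0` the horizontal direction `(a, b)` is parallel to the horizontal displacement from
  -- `y`.
  obtain ⟨r, hr⟩ : ∃ r, r = (X 1 - C (y 1)) * b - (X 2 - C (y 2)) * a := ⟨_, rfl⟩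
  have hGr : (X 1 - C (y 1)) * V 2 - (X 2 - C (y 2)) * V 1 = r * G := by
    rw [← hGa, ← hGb, hr]; ring
  have hmeet : ∀ {K : Type} [Field K] (ψ : MvPolynomial (Fin 3) ℝ →+* K), ψ r = 0 →
      ψ (V 1) = 0 ∧ ψ (V 2) = 0 := fun ψ hψ => by
    have h := congrArg ψ hGr
    rw [map_mul ψ r, hψ, zero_mul, map_sub, map_mul, map_mul, sub_eq_zero] at h
    exact ⟨map_eq_zero_of_meets ψ hV y (by decide) hy1 hy2 hy0 h,
      map_eq_zero_of_meets ψ hV y (by decide) hy2 hy1 hy0 h.symm⟩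
  have hr0 : r ≠ 0 := fun h => by
    have := (hmeet (algebraMap _ (FractionRing (MvPolynomial (Fin 3) ℝ))) (by rw [h, map_zero])).1
    exact hV1 ((map_eq_zero_iff _ (IsFractionRing.injective _ _)).mp this)
  have hDr : mkDerivation ℝ V r = 0 := by
    refine derivation_eq_zero_of_mul hV (q := G) (mul_ne_zero hr0 hG) ?_
    rw [← hGr, map_sub, Derivation.leibniz, Derivation.leibniz, hDX, hDX, hV, hV]
    simp only [smul_eq_mul]; ring
  -- At the generic point of `q = 0` the field is vertical, so `q` divides `V 1` and `V 2`. Since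
  -- `q` is constant along the field, it divides `V 0 * ∂₀q`, and by coprimality `∂₀q`.
  have hprime : ∀ q, Prime q → q ∣ r → pderiv 0 q = 0 := fun q hq hqr => by
    have hI : (Ideal.span {q}).IsPrime := (Ideal.span_singleton_prime hq.ne_zero).mpr hq
    obtain ⟨h1, h2⟩ := hmeet ((algebraMap (MvPolynomial (Fin 3) ℝ ⧸ Ideal.span {q})
      (FractionRing (MvPolynomial (Fin 3) ℝ ⧸ Ideal.span {q}))).comp (Ideal.Quotient.mk _)) (by
        rw [RingHom.comp_apply, Ideal.Quotient.eq_zero_iff_mem.mpr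
          (Ideal.mem_span_singleton.mpr hqr), map_zero])
    rw [RingHom.comp_apply, map_eq_zero_iff _ (IsFractionRing.injective _ _),
      Ideal.Quotient.eq_zero_iff_mem, Ideal.mem_span_singleton] at h1 h2
    have hD := derivation_eq_zero_of_dvd hV hr0 hqr hDr
    rw [hsum] at hD
    have hdvd : q ∣ V 0 * pderiv 0 q := by
      rw [show V 0 * pderiv 0 q = -(V 1 * pderiv 1 q + V 2 * pderiv 2 q) by linear_combination hD]
      exact (dvd_add (h1.mul_right _) (h2.mul_right _)).neg_right
    rcases hq.dvd_or_dvd hdvd with h0 | h0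
    · exact absurd (hcop q fun | 0 => h0 | 1 => h1 | 2 => h2) hq.not_isUnit
    · exact pderiv_eq_zero_of_self_dvd h0
  have hr1 : pderiv 0 r = 0 := by
    have : ∀ q : MvPolynomial (Fin 3) ℝ, q ∣ r → pderiv 0 q = 0 := fun q => by
      refine UniqueFactorizationMonoid.induction_on_prime q (fun _ => map_zero _)
        (fun u hu _ => pderiv_eq_zero_of_isUnit 0 hu) fun q π _ hπ ih h => ?_
      rw [pderiv_mul_eq, hprime π hπ (dvd_of_mul_right_dvd h), ih (dvd_of_mul_left_dvd h)]
      ring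
    exact this r dvd_rfl
  have hE : a * pderiv 1 r + b * pderiv 2 r = 0 := by
    rw [hsum, hr1, ← hGa, ← hGb] at hDr
    exact (mul_eq_zero.mp (show G * (a * pderiv 1 r + b * pderiv 2 r) = 0 by
      linear_combination hDr)).resolve_left hG
  have hE0 : pderiv 0 a * pderiv 1 r + pderiv 0 b * pderiv 2 r = 0 := by
    have h := congrArg (pderiv 0) hE
    rw [map_add, pderiv_mul_eq, pderiv_mul_eq, pderiv_pderiv_comm 0 1, pderiv_pderiv_comm 0 2, hr1,
      map_zero, map_zero, map_zero] at h
    linear_combination h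
  -- Otherwise `hE` and `hE0` form a nonsingular system for `∂₁r` and `∂₂r`, so `r` is constant; but
  -- `r` vanishes at `y` and is not zero.
  have hwr : a * pderiv 0 b = b * pderiv 0 a := by
    by_contra hne
    have hne' := sub_ne_zero.mpr hne
    have h1 : pderiv 1 r = 0 := (mul_eq_zero.mp (show (a * pderiv 0 b - b * pderiv 0 a) *
      pderiv 1 r = 0 by linear_combination pderiv 0 b * hE - b * hE0)).resolve_left hne'
    have h2 : pderiv 2 r = 0 := (mul_eq_zero.mp (show (a * pderiv 0 b - b * pderiv 0 a) *
      pderiv 2 r = 0 by linear_combination a * hE0 - pderiv 0 a * hE)).resolve_left hne'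
    have hc := eq_C_of_pderiv_eq_zero (p := r) (fun | 0 => hr1 | 1 => h1 | 2 => h2)
    have hev : eval y r = 0 := by simp [hr]
    rw [hc, eval_C] at hev
    rw [hev, map_zero] at hc
    exact hr0 hc
  exact ⟨a, b, G, hGa, hGb, pderiv_eq_zero_of_self_dvd (hab.dvd_of_dvd_mul_left ⟨_, hwr.symm⟩),
    pderiv_eq_zero_of_self_dvd (hab.symm.dvd_of_dvd_mul_left ⟨_, hwr⟩)⟩

/-- The components of a coprime straight-line field which is vertical at some point are linearly
dependent. -/
theorem exists_linear_relation_of_vertical {V : Fin 3 → MvPolynomial (Fin 3) ℝ}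
    (hcop : ∀ q, (∀ i, q ∣ V i) → IsUnit q) (hV : ∀ i, mkDerivation ℝ V (V i) = 0)
    {y : Fin 3 → ℝ} (hy0 : eval y (V 0) = 1) (hy1 : eval y (V 1) = 0) (hy2 : eval y (V 2) = 0) :
    ∃ l : Fin 3 → ℝ, l ≠ 0 ∧ ∑ i, C (l i) * V i = 0 := by
  by_cases hV1 : V 1 = 0
  · exact ⟨![0, 1, 0], fun h => by simpa using congrFun h 1, by simp [Fin.sum_univ_three, hV1]⟩
  obtain ⟨a, b, G, hGa, hGb, ha0, hb0⟩ :=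
    exists_horizontal_factors_of_vertical hcop hV hy0 hy1 hy2 hV1
  have hG : G ≠ 0 := fun h => hV1 (by rw [← hGa, h, zero_mul])
  have ha : a ≠ 0 := fun h => hV1 (by rw [← hGa, h, mul_zero])
  have hDa : mkDerivation ℝ V a = 0 :=
    derivation_eq_zero_of_dvd hV hV1 ⟨G, by rw [← hGa, mul_comm]⟩ (hV 1)
  have hDb : mkDerivation ℝ V b = 0 := by
    by_cases hb : b = 0
    · rw [hb, map_zero]
    · exact derivation_eq_zero_of_dvd hV (by rw [← hGb]; exact mul_ne_zero hG hb)
        ⟨G, by rw [← hGb, mul_comm]⟩ (hV 2)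
  -- On polynomials free of `x 0`, the derivation along `V` is `G` times the one along `(0, a, b)`.
  have hU : ∀ p, pderiv 0 p = 0 → mkDerivation ℝ V p = 0 → mkDerivation ℝ ![0, a, b] p = 0 :=
    fun p h0 hp => by
      rw [mkDerivation_eq_sum_pderiv, Fin.sum_univ_three, h0, ← hGa, ← hGb] at hp
      rw [mkDerivation_eq_sum_pderiv, Fin.sum_univ_three]
      simp only [Matrix.cons_val]
      exact (mul_eq_zero.mp (show G * _ = 0 by linear_combination hp)).resolve_left hG
  have hUU : ∀ i, mkDerivation ℝ ![0, a, b] (![0, a, b] i) = 0 := fun i => by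
    match i with
    | 0 => exact map_zero _
    | 1 => exact hU a ha0 hDa
    | 2 => exact hU b hb0 hDb
  obtain ⟨z, hz⟩ := exists_eval_ne_zero ha
  have hpar : C (eval z b) * a = C (eval z a) * b := by
    refine MvPolynomial.funext fun x => ?_
    rw [map_mul, map_mul, eval_C, eval_C]
    -- Moving `z` vertically into the plane of `x` changes neither `a` nor `b`, so the direction is
    -- the same in all planes.
    have h := eval_mul_eval_eq_of_plane (V := ![0, a, b]) rfl hUU
      (x := Function.update z 0 (z 0 + (x 0 - z 0))) (y := x) (by simp)
    simp only [Matrix.cons_val] at h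
    rw [eval_update_add (by rw [ha0, map_zero]), eval_update_add (by rw [hb0, map_zero]), ha0, hb0,
      map_zero, mul_zero, add_zero, add_zero] at h
    exact h.symm
  refine ⟨![0, eval z b, -eval z a], fun h => hz (by simpa using congrFun h 2), ?_⟩
  simp only [Fin.sum_univ_three, Matrix.cons_val, map_zero, zero_mul, ← hGa, ← hGb, map_neg]
  linear_combination G * hpar

end Field

/-! ### Linear changes of coordinates -/

section Coordinates

open MvPolynomial Matrix

/-- The linear substitution `p ↦ p ∘ A`. -/
noncomputable def linSubst (A : Matrix (Fin 3) (Fin 3) ℝ) :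
    MvPolynomial (Fin 3) ℝ →ₐ[ℝ] MvPolynomial (Fin 3) ℝ :=
  aeval fun i => ∑ j, C (A i j) * X j

theorem linSubst_X (A : Matrix (Fin 3) (Fin 3) ℝ) (i : Fin 3) :
    linSubst A (X i) = ∑ j, C (A i j) * X j := by simp [linSubst]

theorem linSubst_C (A : Matrix (Fin 3) (Fin 3) ℝ) (a : ℝ) : linSubst A (C a) = C a :=
  (linSubst A).commutes a

theorem eval_linSubst (A : Matrix (Fin 3) (Fin 3) ℝ) (p : MvPolynomial (Fin 3) ℝ)
    (x : Fin 3 → ℝ) : eval x (linSubst A p) = eval (A.mulVec x) p := by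
  induction p using MvPolynomial.induction_on with
  | C a => rw [linSubst_C, eval_C, eval_C]
  | add p q hp hq => rw [map_add, map_add, map_add, hp, hq]
  | mul_X p i hp => simp [hp, linSubst_X, mulVec, dotProduct]

theorem linSubst_linSubst {A B : Matrix (Fin 3) (Fin 3) ℝ} (h : A * B = 1)
    (p : MvPolynomial (Fin 3) ℝ) : linSubst B (linSubst A p) = p :=
  MvPolynomial.funext fun x => by
    rw [eval_linSubst, eval_linSubst, mulVec_mulVec, h, one_mulVec]

theorem isUnit_of_isUnit_linSubst {A B : Matrix (Fin 3) (Fin 3) ℝ} (h : A * B = 1)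
    {p : MvPolynomial (Fin 3) ℝ} (hp : IsUnit (linSubst A p)) : IsUnit p := by
  rw [← linSubst_linSubst h p]
  exact hp.map _

theorem pderiv_linSubst (A : Matrix (Fin 3) (Fin 3) ℝ) (p : MvPolynomial (Fin 3) ℝ) (j : Fin 3) :
    pderiv j (linSubst A p) = ∑ i, C (A i j) * linSubst A (pderiv i p) := by
  rw [linSubst, derivation_aeval]
  refine Finset.sum_congr rfl fun i _ => ?_
  rw [mul_comm]
  congr 1
  simp [pderiv_X, Pi.single_apply]

/-- The field `V` in the coordinates `x` such that the old ones are `A x`, where `B = A⁻¹`. -/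
noncomputable def pullField (A B : Matrix (Fin 3) (Fin 3) ℝ) (V : Fin 3 → MvPolynomial (Fin 3) ℝ) :
    Fin 3 → MvPolynomial (Fin 3) ℝ :=
  fun j => ∑ i, C (B j i) * linSubst A (V i)

theorem sum_mul_pullField {A B : Matrix (Fin 3) (Fin 3) ℝ} (h : A * B = 1)
    (V : Fin 3 → MvPolynomial (Fin 3) ℝ) (i : Fin 3) :
    ∑ j, C (A i j) * pullField A B V j = linSubst A (V i) := by
  simp only [pullField, Finset.mul_sum]
  rw [Finset.sum_comm]
  have : ∀ l, ∑ j, C (A i j) * (C (B j l) * linSubst A (V l)) =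
      C ((A * B) i l) * linSubst A (V l) := fun l => by
    rw [Matrix.mul_apply, map_sum, Finset.sum_mul]
    exact Finset.sum_congr rfl fun j _ => by rw [map_mul, mul_assoc]
  simp only [this, h, Matrix.one_apply]
  simp

theorem mkDerivation_pullField {A B : Matrix (Fin 3) (Fin 3) ℝ} (h : A * B = 1)
    (V : Fin 3 → MvPolynomial (Fin 3) ℝ) (p : MvPolynomial (Fin 3) ℝ) :
    mkDerivation ℝ (pullField A B V) (linSubst A p) = linSubst A (mkDerivation ℝ V p) := by
  rw [linSubst, derivation_aeval, ← linSubst, mkDerivation_eq_sum_pderiv, map_sum]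
  refine Finset.sum_congr rfl fun i _ => ?_
  rw [map_mul, mul_comm, ← sum_mul_pullField h, map_sum]
  simp [mkDerivation_X]

theorem mkDerivation_pullField_self {A B : Matrix (Fin 3) (Fin 3) ℝ} (h : A * B = 1)
    {V : Fin 3 → MvPolynomial (Fin 3) ℝ} (hV : ∀ i, mkDerivation ℝ V (V i) = 0) (j : Fin 3) :
    mkDerivation ℝ (pullField A B V) (pullField A B V j) = 0 := by
  conv_lhs => rw [show pullField A B V j = ∑ i, C (B j i) * linSubst A (V i) from rfl]
  simp [mkDerivation_pullField h, hV]

theorem pullField_coprime {A B : Matrix (Fin 3) (Fin 3) ℝ} (h : A * B = 1)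
    {V : Fin 3 → MvPolynomial (Fin 3) ℝ} (hcop : ∀ q, (∀ i, q ∣ V i) → IsUnit q)
    (q : MvPolynomial (Fin 3) ℝ) (hq : ∀ i, q ∣ pullField A B V i) : IsUnit q := by
  refine isUnit_of_isUnit_linSubst (mul_eq_one_comm.mp h) (hcop _ fun i => ?_)
  rw [← linSubst_linSubst h (V i), ← sum_mul_pullField h]
  exact map_dvd (linSubst B) (Finset.dvd_sum fun j _ => (hq j).mul_left _)

theorem exists_matrix_col_eq {v : Fin 3 → ℝ} (hv : v ≠ 0) :
    ∃ A : Matrix (Fin 3) (Fin 3) ℝ, IsUnit A.det ∧ ∀ i, A i 0 = v i := by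
  obtain ⟨i, hi⟩ := Function.ne_iff.mp hv
  fin_cases i
  · refine ⟨!![v 0, 0, 0; v 1, 1, 0; v 2, 0, 1], ?_, fun i => by fin_cases i <;> rfl⟩
    simpa [det_fin_three] using hi
  · refine ⟨!![v 0, 1, 0; v 1, 0, 0; v 2, 0, 1], ?_, fun i => by fin_cases i <;> rfl⟩
    simpa [det_fin_three] using hi
  · refine ⟨!![v 0, 0, 1; v 1, 1, 0; v 2, 0, 0], ?_, fun i => by fin_cases i <;> rfl⟩
    simpa [det_fin_three] using hi

/-- A nonzero value of `V` becomes the first basis vector in suitable linear coordinates, and a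
linear relation can be carried back. -/
theorem exists_linear_relation {V : Fin 3 → MvPolynomial (Fin 3) ℝ}
    (hcop : ∀ q, (∀ i, q ∣ V i) → IsUnit q) (hV : ∀ i, mkDerivation ℝ V (V i) = 0) :
    ∃ l : Fin 3 → ℝ, l ≠ 0 ∧ ∑ i, C (l i) * V i = 0 := by
  obtain ⟨i, hi⟩ : ∃ i, V i ≠ 0 := by
    by_contra! h
    exact not_isUnit_zero (hcop 0 fun i => by rw [h])
  obtain ⟨y, hy⟩ := exists_eval_ne_zero hi
  obtain ⟨A, hA, hcol⟩ := exists_matrix_col_eq (v := fun i => eval y (V i))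
    (fun h => hy (congrFun h i))
  have hAB : A * A⁻¹ = 1 := mul_nonsing_inv A hA
  have hBA : A⁻¹ * A = 1 := nonsing_inv_mul A hA
  have hval : ∀ j, eval (A⁻¹.mulVec y) (pullField A A⁻¹ V j) = (1 : Matrix (Fin 3) (Fin 3) ℝ) j 0 :=
    fun j => by
      rw [← hBA, Matrix.mul_apply]
      simp [pullField, eval_linSubst, mulVec_mulVec, hAB, hcol]
  obtain ⟨l, hl, hrel⟩ := exists_linear_relation_of_vertical (pullField_coprime hAB hcop)
    (mkDerivation_pullField_self hAB hV) (y := A⁻¹.mulVec y) (by simp [hval]) (by simp [hval])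
    (by simp [hval])
  refine ⟨vecMul l A⁻¹, fun h => hl ?_, ?_⟩
  · rw [← vecMul_one l, ← hBA, ← vecMul_vecMul, h, zero_vecMul]
  · have h := congrArg (linSubst A⁻¹) hrel
    rw [map_zero, map_sum] at h
    rw [← h]
    simp only [pullField, map_mul, map_sum, linSubst_C, linSubst_linSubst hAB, Finset.mul_sum,
      vecMul, dotProduct, Finset.sum_mul]
    rw [Finset.sum_comm]
    simp only [mul_assoc]

end Coordinates

/-! ### Polynomials with singular Hessian -/

section Classification

open MvPolynomial Matrix

/-- A coprime straight-line field with vanishing component `V 0` depends only on `x 0`. -/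
theorem pderiv_eq_zero_of_plane {V : Fin 3 → MvPolynomial (Fin 3) ℝ} (h0 : V 0 = 0)
    (hrel : IsRelPrime (V 1) (V 2)) (hV : ∀ i, mkDerivation ℝ V (V i) = 0) {j : Fin 3}
    (hj : j ≠ 0) : pderiv j (V 1) = 0 ∧ pderiv j (V 2) = 0 := by
  have h : V 1 * pderiv j (V 2) = V 2 * pderiv j (V 1) := mul_pderiv_eq_of_eval fun x t =>
    eval_mul_eval_eq_of_plane h0 hV (by simp [Function.update_of_ne hj.symm])
  exact ⟨pderiv_eq_zero_of_self_dvd (hrel.dvd_of_dvd_mul_left ⟨_, h.symm⟩),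
    pderiv_eq_zero_of_self_dvd (hrel.symm.dvd_of_dvd_mul_left ⟨_, h⟩)⟩

/-- The Hessian block in `x 1`, `x 2` kills both `(V 1, V 2)` and its derivative in `x 0`. If these
are independent the block is zero. If not, coprimality makes `V` constant; then `E`, the derivative
of `f` along `V`, is a constant that vanishes at `0`. -/
theorem constant_or_affine_of_plane {f : MvPolynomial (Fin 3) ℝ}
    (hgrad : ∀ i, eval 0 (pderiv i f) = 0) {V : Fin 3 → MvPolynomial (Fin 3) ℝ} (h0 : V 0 = 0)
    (hcop : ∀ q, (∀ i, q ∣ V i) → IsUnit q) (hV : ∀ i, mkDerivation ℝ V (V i) = 0)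
    (hf : ∀ i, mkDerivation ℝ V (pderiv i f) = 0) :
    (∃ c : Fin 3 → ℝ, c ≠ 0 ∧ ∀ x : Fin 3 → ℝ, ∀ t : ℝ, eval (x + t • c) f = eval x f) ∨
      pderiv 1 (pderiv 1 f) = 0 ∧ pderiv 2 (pderiv 1 f) = 0 ∧ pderiv 2 (pderiv 2 f) = 0 := by
  have hrel : IsRelPrime (V 1) (V 2) := fun q h1 h2 =>
    hcop q fun | 0 => h0 ▸ dvd_zero q | 1 => h1 | 2 => h2
  obtain ⟨h11, h12⟩ := pderiv_eq_zero_of_plane h0 hrel hV (j := 1) (by decide)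
  obtain ⟨h21, h22⟩ := pderiv_eq_zero_of_plane h0 hrel hV (j := 2) (by decide)
  have hsum : ∀ p, mkDerivation ℝ V p = V 1 * pderiv 1 p + V 2 * pderiv 2 p := fun p => by
    rw [mkDerivation_eq_sum_pderiv, Fin.sum_univ_three, h0]; ring
  have hf0 := hf 0
  have hf1 := hf 1
  have hf2 := hf 2
  rw [hsum] at hf0 hf1 hf2
  obtain ⟨E, hE⟩ : ∃ E, E = V 1 * pderiv 1 f + V 2 * pderiv 2 f := ⟨_, rfl⟩
  have hE1 : pderiv 1 E = 0 := by
    rw [hE, map_add, pderiv_mul_eq, pderiv_mul_eq, h11, h12, pderiv_pderiv_comm 1 2]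
    linear_combination hf1
  have hE2 : pderiv 2 E = 0 := by
    rw [hE, map_add, pderiv_mul_eq, pderiv_mul_eq, h21, h22, pderiv_pderiv_comm 2 1]
    linear_combination hf2
  have hE0 : pderiv 0 E = pderiv 0 (V 1) * pderiv 1 f + pderiv 0 (V 2) * pderiv 2 f := by
    rw [hE, map_add, pderiv_mul_eq, pderiv_mul_eq, pderiv_pderiv_comm 0 1, pderiv_pderiv_comm 0 2]
    linear_combination hf0
  have hd1 : pderiv 0 (V 1) * pderiv 1 (pderiv 1 f) +
      pderiv 0 (V 2) * pderiv 1 (pderiv 2 f) = 0 := by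
    have h := congrArg (pderiv 1) hE0
    rw [pderiv_pderiv_comm 1 0, hE1, map_zero, map_add, pderiv_mul_eq, pderiv_mul_eq,
      pderiv_pderiv_comm 1 0, pderiv_pderiv_comm 1 0, h11, h12, map_zero] at h
    linear_combination -h
  have hd2 : pderiv 0 (V 1) * pderiv 1 (pderiv 2 f) +
      pderiv 0 (V 2) * pderiv 2 (pderiv 2 f) = 0 := by
    have h := congrArg (pderiv 2) hE0
    rw [pderiv_pderiv_comm 2 0, hE2, map_zero, map_add, pderiv_mul_eq, pderiv_mul_eq,
      pderiv_pderiv_comm 2 0, pderiv_pderiv_comm 2 0, h21, h22, map_zero,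
      pderiv_pderiv_comm 2 1] at h
    linear_combination -h
  rw [pderiv_pderiv_comm 2 1] at hf1
  rw [pderiv_pderiv_comm 2 1]
  by_cases hdet : V 1 * pderiv 0 (V 2) = V 2 * pderiv 0 (V 1)
  · left
    have h01 : pderiv 0 (V 1) = 0 :=
      pderiv_eq_zero_of_self_dvd (hrel.dvd_of_dvd_mul_left ⟨_, hdet.symm⟩)
    have h02 : pderiv 0 (V 2) = 0 :=
      pderiv_eq_zero_of_self_dvd (hrel.symm.dvd_of_dvd_mul_left ⟨_, hdet⟩)
    have hV1 := eq_C_of_pderiv_eq_zero (p := V 1) (fun | 0 => h01 | 1 => h11 | 2 => h21)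
    have hV2 := eq_C_of_pderiv_eq_zero (p := V 2) (fun | 0 => h02 | 1 => h12 | 2 => h22)
    have hEz : E = 0 := by
      have hc := eq_C_of_pderiv_eq_zero (p := E)
        (fun | 0 => by rw [hE0, h01, h02]; ring | 1 => hE1 | 2 => hE2)
      have hev : eval 0 E = 0 := by rw [hE, map_add, map_mul, map_mul, hgrad, hgrad]; ring
      rw [hc, eval_C] at hev
      rw [hc, hev, map_zero]
    have hDf : mkDerivation ℝ V f = 0 := by rw [hsum, ← hE, hEz]
    refine ⟨![0, (V 1).coeff 0, (V 2).coeff 0], fun h => ?_, fun x t => ?_⟩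
    · have e1 : (V 1).coeff 0 = 0 := congrFun h 1
      have e2 : (V 2).coeff 0 = 0 := congrFun h 2
      rw [e1, map_zero] at hV1
      rw [e2, map_zero] at hV2
      exact not_isUnit_zero (hrel (hV1 ▸ dvd_rfl) (hV2 ▸ dvd_rfl))
    · have h := eval_add_smul hV (p := f) (by rw [hDf, map_zero]) x t
      rw [hDf, map_zero, mul_zero, add_zero] at h
      rw [← h]
      congr 2
      funext i
      match i with
      | 0 => simp [h0]
      | 1 => exact congrArg (x 1 + t * ·) (by rw [hV1, eval_C, coeff_C, if_pos rfl]; rfl)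
      | 2 => exact congrArg (x 2 + t * ·) (by rw [hV2, eval_C, coeff_C, if_pos rfl]; rfl)
  · right
    have hne := sub_ne_zero.mpr hdet
    have h12f : pderiv 1 (pderiv 2 f) = 0 := (mul_eq_zero.mp (show
      (V 1 * pderiv 0 (V 2) - V 2 * pderiv 0 (V 1)) * pderiv 1 (pderiv 2 f) = 0 by
        linear_combination V 1 * hd1 - pderiv 0 (V 1) * hf1)).resolve_left hne
    refine ⟨(mul_eq_zero.mp (show (V 1 * pderiv 0 (V 2) - V 2 * pderiv 0 (V 1)) *
      pderiv 1 (pderiv 1 f) = 0 by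
        linear_combination pderiv 0 (V 2) * hf1 - V 2 * hd1)).resolve_left hne, h12f,
      (mul_eq_zero.mp (show (V 1 * pderiv 0 (V 2) - V 2 * pderiv 0 (V 1)) *
        pderiv 2 (pderiv 2 f) = 0 by
        linear_combination V 1 * hd2 - pderiv 0 (V 1) * hf2)).resolve_left hne⟩

theorem exists_affine_form {f : MvPolynomial (Fin 3) ℝ} (h11 : pderiv 1 (pderiv 1 f) = 0)
    (h21 : pderiv 2 (pderiv 1 f) = 0) (h22 : pderiv 2 (pderiv 2 f) = 0) :
    ∃ Q₁ Q₂ Q₃ : Polynomial ℝ, ∀ x : Fin 3 → ℝ,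
      eval x f = Q₁.eval (x 0) + Q₂.eval (x 0) * x 1 + Q₃.eval (x 0) * x 2 := by
  have hrestr : ∀ (p : MvPolynomial (Fin 3) ℝ) (s : ℝ),
      (aeval ![Polynomial.X, 0, 0] p : Polynomial ℝ).eval s = eval ![s, 0, 0] p := fun p s => by
    induction p using MvPolynomial.induction_on with
    | C a => simp
    | add p q hp hq => simp [hp, hq]
    | mul_X p i hp => fin_cases i <;> simp [hp]
  -- The coefficients are `f`, `∂₁f` and `∂₂f` restricted to the first axis.
  refine ⟨aeval ![Polynomial.X, 0, 0] f, aeval ![Polynomial.X, 0, 0] (pderiv 1 f),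
    aeval ![Polynomial.X, 0, 0] (pderiv 2 f), fun x => ?_⟩
  rw [hrestr, hrestr, hrestr]
  have e1 : Function.update ![x 0, 0, x 2] 1 (![x 0, 0, x 2] 1 + x 1) = x := by
    funext i; fin_cases i <;> simp
  have e2 : Function.update ![x 0, 0, 0] 2 (![x 0, 0, 0] 2 + x 2) = ![x 0, 0, x 2] := by
    funext i; fin_cases i <;> simp
  have s1 := eval_update_add h11 ![x 0, 0, x 2] (x 1)
  have s2 := eval_update_add h22 ![x 0, 0, 0] (x 2)
  have s3 := eval_update_add (p := pderiv 1 f) (j := 2) (by rw [h21, map_zero]) ![x 0, 0, 0] (x 2)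
  rw [e1] at s1
  rw [e2] at s2 s3
  rw [h21, map_zero] at s3
  rw [s1, s2, s3]
  ring

/-- A polynomial in three variables with singular Hessian and without linear part either is
constant in some direction, or is affine in two variables with coefficients depending on the third,
after a linear change of coordinates. -/
theorem singular_hessian_classification {f : MvPolynomial (Fin 3) ℝ}
    (hgrad : ∀ i, eval 0 (pderiv i f) = 0) (hf : (hessianMatrix f).det = 0) :
    ∃ A : Matrix (Fin 3) (Fin 3) ℝ, IsUnit A.det ∧
      ((∀ x : Fin 3 → ℝ, eval (A.mulVec x) f = eval (A.mulVec ![x 0, x 1, 0]) f) ∨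
        ∃ Q₁ Q₂ Q₃ : Polynomial ℝ, ∀ x : Fin 3 → ℝ, eval (A.mulVec x) f =
          Q₁.eval (x 0) + Q₂.eval (x 0) * x 1 + Q₃.eval (x 0) * x 2) := by
  obtain ⟨V, hcop, hV, hVf⟩ := exists_kernel_field f hf
  obtain ⟨l, hl, hrel⟩ := exists_linear_relation hcop hV
  obtain ⟨M, hM, hcol⟩ := exists_matrix_col_eq hl
  -- The first row of `B` is `l`, so the relation says that the new component `0` of the field
  -- vanishes.
  obtain ⟨B, hB⟩ : ∃ B, B = Mᵀ := ⟨_, rfl⟩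
  have hBdet : IsUnit B.det := by rwa [hB, det_transpose]
  have hAB : B⁻¹ * B = 1 := nonsing_inv_mul B hBdet
  have hAdet : IsUnit B⁻¹.det := by rwa [isUnit_nonsing_inv_det_iff]
  have hgrad' : ∀ i, eval 0 (pderiv i (linSubst B⁻¹ f)) = 0 := fun i => by
    rw [pderiv_linSubst, map_sum]
    exact Finset.sum_eq_zero fun j _ => by
      rw [map_mul, eval_linSubst, mulVec_zero, hgrad, mul_zero]
  have hU0 : pullField B⁻¹ B V 0 = 0 := by
    have h := congrArg (linSubst B⁻¹) hrel
    rw [map_sum, map_zero] at h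
    rw [← h]
    refine Finset.sum_congr rfl fun i _ => ?_
    rw [map_mul, linSubst_C, hB, transpose_apply, hcol]
  have hUf : ∀ i, mkDerivation ℝ (pullField B⁻¹ B V) (pderiv i (linSubst B⁻¹ f)) = 0 := fun i => by
    simp [pderiv_linSubst, mkDerivation_pullField hAB, hVf]
  rcases constant_or_affine_of_plane hgrad' hU0 (pullField_coprime hAB hcop)
    (mkDerivation_pullField_self hAB hV) hUf with ⟨c, hc, hcf⟩ | ⟨h11, h21, h22⟩
  · obtain ⟨N, hN, hNcol⟩ := exists_matrix_col_eq hc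
    -- `P` exchanges the first and last coordinates, which makes `c` the last column of `N * P`.
    obtain ⟨P, hP⟩ : ∃ P : Matrix (Fin 3) (Fin 3) ℝ, P = !![0, 0, 1; 0, 1, 0; 1, 0, 0] := ⟨_, rfl⟩
    refine ⟨B⁻¹ * (N * P), ?_, Or.inl fun x => ?_⟩
    · rw [det_mul, det_mul]
      refine hAdet.mul (hN.mul ?_)
      simp [hP, det_fin_three]
    · have hx : (N * P).mulVec x = (N * P).mulVec ![x 0, x 1, 0] + x 2 • c := by
        funext i
        simp [hP, mulVec, dotProduct, Matrix.mul_apply, Fin.sum_univ_three, ← hNcol]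
        ring
      rw [← mulVec_mulVec x, ← mulVec_mulVec ![x 0, x 1, 0], ← eval_linSubst B⁻¹,
        ← eval_linSubst B⁻¹, hx, hcf]
  · obtain ⟨Q₁, Q₂, Q₃, hQ⟩ := exists_affine_form h11 h21 h22
    exact ⟨B⁻¹, hAdet, Or.inr ⟨Q₁, Q₂, Q₃, fun x => by rw [← hQ, eval_linSubst]⟩⟩

end Classification

/-! ### Local analytic changes of coordinates -/

section LocalChange

open Filter Topology

/-- Analytic inverse function theorem, for functions given by their components. -/
theorem exists_isLocalAnalyticChange {g : Fin 3 → (Fin 3 → ℝ) → ℝ}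
    {g' : Fin 3 → (Fin 3 → ℝ) →L[ℝ] ℝ} (hg : ∀ i, AnalyticAt ℝ (g i) 0) (hg0 : ∀ i, g i 0 = 0)
    (hg' : ∀ i, HasFDerivAt (g i) (g' i) 0) (hinj : ∀ v, (∀ i, g' i v = 0) → v = 0)
    {P : (Fin 3 → ℝ) → Prop} (hP : ∀ᶠ x in 𝓝 0, P x) :
    ∃ e : OpenPartialHomeomorph (Fin 3 → ℝ) (Fin 3 → ℝ), IsLocalAnalyticChange e ∧
      ∀ y ∈ e.source, P (e y) ∧ ∀ i, g i (e y) = y i := by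
  obtain ⟨G, hG⟩ : ∃ G : (Fin 3 → ℝ) → (Fin 3 → ℝ), G = fun x i => g i x := ⟨_, rfl⟩
  have hGan : AnalyticAt ℝ G 0 := hG ▸ AnalyticAt.pi hg
  have hG0 : G 0 = 0 := by rw [hG]; exact funext hg0
  have hGd : HasFDerivAt G (ContinuousLinearMap.pi g') 0 := by
    rw [hG]; exact hasFDerivAt_pi.mpr hg'
  have hinj' : Function.Injective (ContinuousLinearMap.pi g' : (Fin 3 → ℝ) →ₗ[ℝ] (Fin 3 → ℝ)) := by
    rw [injective_iff_map_eq_zero]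
    exact fun v hv => hinj v fun i => congrFun hv i
  obtain ⟨L, hL⟩ : ∃ L : (Fin 3 → ℝ) ≃L[ℝ] (Fin 3 → ℝ),
      (L : (Fin 3 → ℝ) →L[ℝ] (Fin 3 → ℝ)) = ContinuousLinearMap.pi g' :=
    ⟨(LinearEquiv.ofInjectiveEndo _ hinj').toContinuousLinearEquiv, by ext; rfl⟩
  have hfd : fderiv ℝ G 0 = L := by rw [hL]; exact hGd.fderiv
  have hstrict : HasStrictFDerivAt G (L : (Fin 3 → ℝ) →L[ℝ] (Fin 3 → ℝ)) 0 :=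
    hfd ▸ hGan.hasStrictFDerivAt
  obtain ⟨R, hR⟩ : ∃ R, R = hstrict.toOpenPartialHomeomorph G := ⟨_, rfl⟩
  have hRG : ⇑R = G := by rw [hR]; rfl
  have h0R : (0 : Fin 3 → ℝ) ∈ R.source := by
    rw [hR]; exact hstrict.mem_toOpenPartialHomeomorph_source
  have hsymm : AnalyticAt ℝ R.symm (G 0) := by
    rw [← hRG]
    exact R.analyticAt_symm' h0R (hRG.symm ▸ hGan) (hRG.symm ▸ hfd)
  have hnear : ∀ᶠ x in 𝓝 0, P x ∧ AnalyticAt ℝ G x ∧ AnalyticAt ℝ R.symm (G x) :=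
    hP.and (hGan.eventually_analyticAt.and
      (hGan.continuousAt.eventually hsymm.eventually_analyticAt))
  obtain ⟨s, hs, hsopen, h0s⟩ := mem_nhds_iff.mp hnear
  have hs' : ∀ y ∈ (R.restrOpen s hsopen).target,
      R.symm y ∈ s ∧ G (R.symm y) = y := fun y hy => by
    have h1 := (R.restrOpen s hsopen).map_target hy
    have h2 := (R.restrOpen s hsopen).right_inv hy
    rw [R.restrOpen_source] at h1
    rw [R.coe_restrOpen, R.coe_restrOpen_symm, hRG] at h2
    exact ⟨h1.2, h2⟩
  have h0src : (0 : Fin 3 → ℝ) ∈ (R.restrOpen s hsopen).source := ⟨h0R, h0s⟩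
  -- The functions `g i` give `y` in terms of `x`, whereas a change is written `x = e y`; hence the
  -- inverse.
  refine ⟨(R.restrOpen s hsopen).symm, ⟨?_, ?_, ?_, ?_⟩,
    fun y hy => ⟨(hs (hs' y hy).1).1, fun i => ?_⟩⟩
  · have := (R.restrOpen s hsopen).map_source h0src
    rwa [R.coe_restrOpen, hRG, hG0] at this
  · have := (R.restrOpen s hsopen).left_inv h0src
    rwa [R.coe_restrOpen, hRG, hG0] at this
  · intro y hy
    have := (hs (hs' y hy).1).2.2
    rwa [(hs' y hy).2] at this
  · intro x hx
    rw [OpenPartialHomeomorph.symm_symm, R.coe_restrOpen, hRG]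
    exact (hs hx.2).2.1
  · have := congrFun (hs' y hy).2 i
    rwa [hG] at this

theorem IsLocalAnalyticChange.exists_mulVec {e : OpenPartialHomeomorph (Fin 3 → ℝ) (Fin 3 → ℝ)}
    (he : IsLocalAnalyticChange e) {A : Matrix (Fin 3) (Fin 3) ℝ} (hA : IsUnit A.det) :
    ∃ e' : OpenPartialHomeomorph (Fin 3 → ℝ) (Fin 3 → ℝ), IsLocalAnalyticChange e' ∧
      e'.source = e.source ∧ ∀ y, e' y = A.mulVec (e y) := by
  obtain ⟨L, hL⟩ : ∃ L : (Fin 3 → ℝ) ≃L[ℝ] (Fin 3 → ℝ), ∀ x, L x = A.mulVec x :=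
    ⟨(LinearEquiv.ofLinearMap (Matrix.toLin' A) (Matrix.toLin' A⁻¹)
      (by rw [← Matrix.toLin'_mul, Matrix.mul_nonsing_inv A hA, Matrix.toLin'_one])
      (by rw [← Matrix.toLin'_mul, Matrix.nonsing_inv_mul A hA,
        Matrix.toLin'_one])).toContinuousLinearEquiv, fun x => rfl⟩
  refine ⟨e.transHomeomorph L.toHomeomorph, ⟨he.zero_mem, ?_, fun y hy => ?_, fun x hx => ?_⟩, rfl,
    fun y => hL _⟩
  · change L (e 0) = 0
    rw [he.map_zero, hL, Matrix.mulVec_zero]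
  · exact (L.analyticAt _).comp (he.analytic y hy)
  · exact (he.analytic_symm _ hx).comp (L.symm.analyticAt _)

theorem isLocalAnalyticChange_refl :
    IsLocalAnalyticChange (OpenPartialHomeomorph.refl (Fin 3 → ℝ)) :=
  ⟨Set.mem_univ _, rfl, fun _ _ => analyticAt_id, fun _ _ => analyticAt_id⟩

end LocalChange

/-! ### Normal forms in the affine case -/

section NormalForms

open Polynomial Filter Topology

theorem analyticAt_coord (i : Fin 3) (z : Fin 3 → ℝ) :
    AnalyticAt ℝ (fun x : Fin 3 → ℝ => x i) z :=
  (ContinuousLinearMap.proj (R := ℝ) (φ := fun _ : Fin 3 => ℝ) i).analyticAt z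

theorem hasFDerivAt_coord (i : Fin 3) (z : Fin 3 → ℝ) :
    HasFDerivAt (fun x : Fin 3 → ℝ => x i)
      (ContinuousLinearMap.proj (R := ℝ) (φ := fun _ : Fin 3 => ℝ) i) z :=
  (ContinuousLinearMap.proj (R := ℝ) (φ := fun _ : Fin 3 => ℝ) i).hasFDerivAt

theorem analyticAt_eval_coord (q : ℝ[X]) (i : Fin 3) (z : Fin 3 → ℝ) :
    AnalyticAt ℝ (fun x : Fin 3 → ℝ => q.eval (x i)) z := by
  simpa using (analyticAt_coord i z).aeval_polynomial q

theorem hasFDerivAt_mul_of_eq_zero {u v : (Fin 3 → ℝ) → ℝ} {u' : (Fin 3 → ℝ) →L[ℝ] ℝ}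
    (hu : HasFDerivAt u u' 0) (hu0 : u 0 = 0) (hv : DifferentiableAt ℝ v 0) :
    HasFDerivAt (fun x => v x * u x) (v 0 • u') 0 := by
  have h := hv.hasFDerivAt.mul hu
  rwa [hu0, zero_smul, add_zero] at h

theorem exists_factor {Q : ℝ[X]} {ν : ℕ} (h : emultiplicity X Q = ν) :
    ∃ q : ℝ[X], Q = X ^ ν * q ∧ q.eval 0 = Q.coeff ν ∧ Q.coeff ν ≠ 0 := by
  obtain ⟨⟨q, hq⟩, hn⟩ := emultiplicity_eq_coe.mp h
  have hc : q.eval 0 = Q.coeff ν := by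
    rw [hq, coeff_X_pow_mul', if_pos le_rfl, Nat.sub_self, coeff_zero_eq_eval_zero]
  refine ⟨q, hq, hc, fun h0 => hn ?_⟩
  rw [hq, pow_succ]
  refine mul_dvd_mul_left _ ?_
  rw [X_dvd_iff, coeff_zero_eq_eval_zero, hc, h0]

/-- If `Q₁` has the lowest order, the form `Q₁ + Q₂ x₂ + Q₃ x₃` is a signed power. -/
theorem exists_change_pow {ψ : (Fin 3 → ℝ) → ℝ} (hψ0 : ψ 0 = 0) {Q₁ Q₂ Q₃ : ℝ[X]}
    (hψ : ∀ x, ψ x = Q₁.eval (x 0) + Q₂.eval (x 0) * x 1 + Q₃.eval (x 0) * x 2) {ν : ℕ}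
    (h1 : emultiplicity X Q₁ = ν) (h2 : (ν : ℕ∞) ≤ emultiplicity X Q₂)
    (h3 : (ν : ℕ∞) ≤ emultiplicity X Q₃) :
    ∃ e : OpenPartialHomeomorph (Fin 3 → ℝ) (Fin 3 → ℝ), IsLocalAnalyticChange e ∧
      ∀ y ∈ e.source, ψ (e y) = Real.sign (Q₁.coeff ν) * y 0 ^ ν := by
  obtain ⟨q₁, hq₁, hc, hne⟩ := exists_factor h1
  obtain ⟨q₂, hq₂⟩ := pow_dvd_of_le_emultiplicity h2
  obtain ⟨q₃, hq₃⟩ := pow_dvd_of_le_emultiplicity h3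
  -- The `ν`-th root below needs `ν ≠ 0`, which comes from `ψ 0 = 0`.
  have hν : ν ≠ 0 := fun h => hne (by
    rw [hψ] at hψ0
    subst h
    simpa [coeff_zero_eq_eval_zero] using hψ0)
  set s := Real.sign (Q₁.coeff ν) with hs
  obtain ⟨u, hu⟩ : ∃ u : (Fin 3 → ℝ) → ℝ,
      u = fun x => q₁.eval (x 0) + q₂.eval (x 0) * x 1 + q₃.eval (x 0) * x 2 := ⟨_, rfl⟩
  have hss : s * s = 1 := by
    rcases lt_or_gt_of_ne hne with h | h
    · rw [hs, Real.sign_of_neg h]; norm_num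
    · rw [hs, Real.sign_of_pos h]; norm_num
  have hψu : ∀ x, ψ x = x 0 ^ ν * u x := fun x => by
    rw [hψ, hq₁, hq₂, hq₃, hu]
    simp only [eval_mul, eval_pow, eval_X]
    ring
  have huan : AnalyticAt ℝ (fun x => s * u x) 0 := by
    rw [hu]
    exact analyticAt_const.mul (((analyticAt_eval_coord _ _ _).add
      ((analyticAt_eval_coord _ _ _).mul (analyticAt_coord _ _))).add
      ((analyticAt_eval_coord _ _ _).mul (analyticAt_coord _ _)))
  have hu0 : 0 < s * u 0 := by
    have : u 0 = Q₁.coeff ν := by simp [hu, hc]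
    rw [this, hs]
    rcases lt_or_gt_of_ne hne with h | h
    · rw [Real.sign_of_neg h]; linarith
    · rw [Real.sign_of_pos h]; linarith
  -- Near `0` this is the positive `ν`-th root of `s * u`; the new first coordinate is `k x * x 0`.
  obtain ⟨k, hk⟩ : ∃ k : (Fin 3 → ℝ) → ℝ, k = fun x => Real.exp (Real.log (s * u x) / ν) := ⟨_, rfl⟩
  have hkan : AnalyticAt ℝ k 0 := by
    rw [hk]
    have hlog : AnalyticAt ℝ (fun x => Real.log (s * u x)) 0 :=
      AnalyticAt.fun_comp (g := Real.log) (analyticAt_id.log hu0) huan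
    exact hlog.div_const.rexp'
  have hk0 : 0 < k 0 := by rw [hk]; exact Real.exp_pos _
  have hkpow : ∀ x, 0 < s * u x → k x ^ ν = s * u x := fun x hx => by
    have hν' : (ν : ℝ) ≠ 0 := by exact_mod_cast hν
    rw [hk]
    simp only
    rw [← Real.exp_nat_mul, mul_div_cancel₀ _ hν', Real.exp_log hx]
  obtain ⟨e, he, hey⟩ := exists_isLocalAnalyticChange
    (g := ![fun x => k x * x 0, fun x => x 1, fun x => x 2])
    (g' := ![k 0 • ContinuousLinearMap.proj 0, ContinuousLinearMap.proj 1,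
      ContinuousLinearMap.proj 2])
    (P := fun x => 0 < s * u x)
    (fun
      | 0 => hkan.mul (analyticAt_coord _ _)
      | 1 => analyticAt_coord _ _
      | 2 => analyticAt_coord _ _)
    (fun | 0 => mul_zero _ | 1 => rfl | 2 => rfl)
    (fun
      | 0 => hasFDerivAt_mul_of_eq_zero (hasFDerivAt_coord _ _) rfl hkan.differentiableAt
      | 1 => hasFDerivAt_coord _ _
      | 2 => hasFDerivAt_coord _ _)
    (fun v hv => funext fun
      | 0 => (mul_eq_zero.mp (hv 0)).resolve_left hk0.ne'
      | 1 => hv 1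
      | 2 => hv 2)
    (huan.continuousAt.eventually_const_lt hu0)
  refine ⟨e, he, fun y hy => ?_⟩
  obtain ⟨hpos, hcoord⟩ := hey y hy
  have h0 : k (e y) * e y 0 = y 0 := hcoord 0
  rw [hψu, ← h0, mul_pow, hkpow _ hpos]
  linear_combination (-(e y 0 ^ ν * u (e y))) * hss

/-- If `Q₂` has the lowest order, strictly lower than `Q₁`, the form `Q₁ + Q₂ x₂ + Q₃ x₃` is
`y₁ ^ ν y₂`. -/
theorem exists_change_pow_mul {ψ : (Fin 3 → ℝ) → ℝ} {Q₁ Q₂ Q₃ : ℝ[X]}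
    (hψ : ∀ x, ψ x = Q₁.eval (x 0) + Q₂.eval (x 0) * x 1 + Q₃.eval (x 0) * x 2) {ν : ℕ}
    (h2 : emultiplicity X Q₂ = ν) (h1 : (ν : ℕ∞) < emultiplicity X Q₁)
    (h3 : (ν : ℕ∞) ≤ emultiplicity X Q₃) :
    ∃ e : OpenPartialHomeomorph (Fin 3 → ℝ) (Fin 3 → ℝ), IsLocalAnalyticChange e ∧
      ∀ y ∈ e.source, ψ (e y) = y 0 ^ ν * y 1 := by
  obtain ⟨q₂, hq₂, hc, hne⟩ := exists_factor h2
  -- The strict inequality leaves one more factor `x 0`, so that the cofactor of `x 0 ^ ν`, taken as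
  -- the new second coordinate, vanishes at `0`.
  have h1' : ((ν + 1 : ℕ) : ℕ∞) ≤ emultiplicity X Q₁ := by
    exact_mod_cast Order.add_one_le_of_lt h1
  obtain ⟨q₁, hq₁⟩ := pow_dvd_of_le_emultiplicity h1'
  obtain ⟨q₃, hq₃⟩ := pow_dvd_of_le_emultiplicity h3
  have hq2 : q₂.eval 0 ≠ 0 := hc ▸ hne
  have han : ∀ (q : ℝ[X]) i, AnalyticAt ℝ (fun x : Fin 3 → ℝ => q.eval (x 0) * x i) 0 := fun q i =>
    (analyticAt_eval_coord q 0 0).mul (analyticAt_coord i 0)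
  have hder : ∀ (q : ℝ[X]) i, HasFDerivAt (fun x : Fin 3 → ℝ => q.eval (x 0) * x i)
      (q.eval 0 • ContinuousLinearMap.proj (R := ℝ) (φ := fun _ : Fin 3 => ℝ) i) 0 := fun q i =>
    hasFDerivAt_mul_of_eq_zero (hasFDerivAt_coord i 0) rfl
      (analyticAt_eval_coord q 0 0).differentiableAt
  obtain ⟨e, he, hey⟩ := exists_isLocalAnalyticChange
    (g := ![fun x => x 0,
      fun x => q₁.eval (x 0) * x 0 + q₂.eval (x 0) * x 1 + q₃.eval (x 0) * x 2, fun x => x 2])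
    (g' := ![ContinuousLinearMap.proj 0, q₁.eval 0 • ContinuousLinearMap.proj 0 +
      q₂.eval 0 • ContinuousLinearMap.proj 1 + q₃.eval 0 • ContinuousLinearMap.proj 2,
      ContinuousLinearMap.proj 2])
    (P := fun _ => True)
    (fun
      | 0 => analyticAt_coord _ _
      | 1 => ((han q₁ 0).add (han q₂ 1)).add (han q₃ 2)
      | 2 => analyticAt_coord _ _)
    (fun | 0 => rfl | 1 => by simp | 2 => rfl)
    (fun
      | 0 => hasFDerivAt_coord _ _
      | 1 => ((hder q₁ 0).add (hder q₂ 1)).add (hder q₃ 2)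
      | 2 => hasFDerivAt_coord _ _)
    (fun v hv => by
      have e0 : v 0 = 0 := hv 0
      have e2 : v 2 = 0 := hv 2
      have e1 : q₁.eval 0 * v 0 + q₂.eval 0 * v 1 + q₃.eval 0 * v 2 = 0 := hv 1
      rw [e0, e2, mul_zero, mul_zero, zero_add, add_zero] at e1
      exact funext fun | 0 => e0 | 1 => (mul_eq_zero.mp e1).resolve_left hq2 | 2 => e2)
    (Eventually.of_forall fun _ => trivial)
  refine ⟨e, he, fun y hy => ?_⟩
  have hcoord := (hey y hy).2
  have e0 : e y 0 = y 0 := hcoord 0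
  have e1 : q₁.eval (e y 0) * e y 0 + q₂.eval (e y 0) * e y 1 + q₃.eval (e y 0) * e y 2 = y 1 :=
    hcoord 1
  rw [hψ, hq₁, hq₂, hq₃, ← e1, ← e0]
  simp only [eval_mul, eval_pow, eval_X]
  ring

end NormalForms

/-! ### Reduction to two variables -/

section Main

open MvPolynomial

theorem exists_two_variable_form_of_affine {ψ : (Fin 3 → ℝ) → ℝ} (hψ0 : ψ 0 = 0)
    {Q₁ Q₂ Q₃ : Polynomial ℝ}
    (hψ : ∀ x, ψ x = Q₁.eval (x 0) + Q₂.eval (x 0) * x 1 + Q₃.eval (x 0) * x 2) :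
    ∃ e : OpenPartialHomeomorph (Fin 3 → ℝ) (Fin 3 → ℝ), IsLocalAnalyticChange e ∧
      ∃ g : ℝ × ℝ → ℝ, AnalyticAt ℝ g 0 ∧ ∀ y ∈ e.source, ψ (e y) = g (y 0, y 1) := by
  have hnat : ∀ m : ℕ∞, m ≠ ⊤ → ∃ ν : ℕ, m = ν := fun m hm =>
    ⟨m.toNat, (ENat.natCast_toNat hm).symm⟩
  have htop : ∀ Q : Polynomial ℝ, emultiplicity Polynomial.X Q = ⊤ → Q = 0 := fun Q hQ => by
    by_contra hne
    exact finiteMultiplicity_iff_emultiplicity_ne_top.mp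
      (FiniteMultiplicity.of_prime_left Polynomial.prime_X hne) hQ
  by_cases h1 : emultiplicity Polynomial.X Q₁ ≤ emultiplicity Polynomial.X Q₂ ∧
      emultiplicity Polynomial.X Q₁ ≤ emultiplicity Polynomial.X Q₃
  · by_cases ht : emultiplicity Polynomial.X Q₁ = ⊤
    · rw [ht, top_le_iff, top_le_iff] at h1
      refine ⟨_, isLocalAnalyticChange_refl, fun _ => 0, analyticAt_const, fun y _ => ?_⟩
      rw [hψ, htop _ ht, htop _ h1.1, htop _ h1.2]
      simp
    · obtain ⟨ν, hν⟩ := hnat _ ht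
      rw [hν] at h1
      obtain ⟨e, he, hey⟩ := exists_change_pow hψ0 hψ hν h1.1 h1.2
      exact ⟨e, he, fun p => Real.sign (Q₁.coeff ν) * p.1 ^ ν,
        analyticAt_const.mul (analyticAt_fst.pow ν), hey⟩
  by_cases h2 : emultiplicity Polynomial.X Q₂ < emultiplicity Polynomial.X Q₁ ∧
      emultiplicity Polynomial.X Q₂ ≤ emultiplicity Polynomial.X Q₃
  · obtain ⟨ν, hν⟩ := hnat _ h2.1.ne_top
    rw [hν] at h2
    obtain ⟨e, he, hey⟩ := exists_change_pow_mul hψ hν h2.1 h2.2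
    exact ⟨e, he, fun p => p.1 ^ ν * p.2, (analyticAt_fst.pow ν).mul analyticAt_snd, hey⟩
  have h3 : emultiplicity Polynomial.X Q₃ < emultiplicity Polynomial.X Q₁ ∧
      emultiplicity Polynomial.X Q₃ ≤ emultiplicity Polynomial.X Q₂ := by
    rw [not_and_or, not_le, not_le] at h1
    rw [not_and_or, not_lt, not_le] at h2
    rcases h1 with h1 | h1
    · rcases h2 with h2 | h2
      · exact absurd h1 h2.not_gt
      · exact ⟨h2.trans h1, h2.le⟩
    · rcases h2 with h2 | h2
      · exact ⟨h1, h1.le.trans h2⟩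
      · exact ⟨h1, h2.le⟩
  obtain ⟨ν, hν⟩ := hnat _ h3.1.ne_top
  rw [hν] at h3
  obtain ⟨S, hS⟩ : ∃ S : Matrix (Fin 3) (Fin 3) ℝ, S = !![1, 0, 0; 0, 0, 1; 0, 1, 0] := ⟨_, rfl⟩
  have hSdet : IsUnit S.det := by simp [hS, Matrix.det_fin_three]
  -- When `Q₃` has the strictly lowest order, `S` exchanges the last two variables.
  obtain ⟨e, he, hey⟩ := exists_change_pow_mul (ψ := fun x => ψ (S.mulVec x)) (Q₁ := Q₁) (Q₂ := Q₃)
    (Q₃ := Q₂) (fun x => by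
      rw [hψ]
      simp [hS, Matrix.mulVec, dotProduct, Fin.sum_univ_three]
      ring) hν h3.1 h3.2
  obtain ⟨e', he', hsrc, hcoe⟩ := he.exists_mulVec hSdet
  exact ⟨e', he', fun p => p.1 ^ ν * p.2, (analyticAt_fst.pow ν).mul analyticAt_snd, fun y hy => by
    rw [hcoe, hey y (hsrc ▸ hy)]⟩

theorem exists_two_variable_form {f : MvPolynomial (Fin 3) ℝ} (h0 : eval 0 f = 0)
    (hgrad : ∀ i, eval 0 (pderiv i f) = 0) (hf : (hessianMatrix f).det = 0) :
    ∃ e : OpenPartialHomeomorph (Fin 3 → ℝ) (Fin 3 → ℝ), IsLocalAnalyticChange e ∧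
      ∃ g : ℝ × ℝ → ℝ, AnalyticAt ℝ g 0 ∧ ∀ y ∈ e.source, eval (e y) f = g (y 0, y 1) := by
  obtain ⟨A, hA, h⟩ := singular_hessian_classification hgrad hf
  obtain ⟨e, he, g, hg, hey⟩ : ∃ e : OpenPartialHomeomorph (Fin 3 → ℝ) (Fin 3 → ℝ),
      IsLocalAnalyticChange e ∧ ∃ g : ℝ × ℝ → ℝ, AnalyticAt ℝ g 0 ∧
        ∀ y ∈ e.source, eval (A.mulVec (e y)) f = g (y 0, y 1) := by
    rcases h with h | ⟨Q₁, Q₂, Q₃, hQ⟩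
    · refine ⟨_, isLocalAnalyticChange_refl, fun p => eval ![p.1, p.2, 0] (linSubst A f), ?_,
        fun y _ => ?_⟩
      · simp only [← coe_aeval_eq_eval]
        refine AnalyticAt.aeval_mvPolynomial (fun i => ?_) _
        match i with
        | 0 => exact analyticAt_fst
        | 1 => exact analyticAt_snd
        | 2 => exact analyticAt_const
      · exact (h y).trans (eval_linSubst A f _).symm
    · exact exists_two_variable_form_of_affine (ψ := fun x => eval (A.mulVec x) f)
        (by simp only [Matrix.mulVec_zero, h0]) hQ
  obtain ⟨e', he', hsrc, hcoe⟩ := he.exists_mulVec hA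
  exact ⟨e', he', g, hg, fun y hy => by rw [hcoe, hey y (hsrc ▸ hy)]⟩

end Main

theorem mainTheorem9 (φ : MvPolynomial (Fin 3) ℝ)
    (hφ0 : MvPolynomial.eval 0 φ = 0)
    (hgrad : ∀ i : Fin 3, MvPolynomial.eval 0 (MvPolynomial.pderiv i φ) = 0)
    (hhess : ∀ x : Fin 3 → ℝ, ((hessianMatrix φ).map (MvPolynomial.eval x)).det = 0) :
    -- after a local analytic change of coordinates, `φ` depends on at most two variables
    (∃ e : OpenPartialHomeomorph (Fin 3 → ℝ) (Fin 3 → ℝ), IsLocalAnalyticChange e ∧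
      ∃ g : ℝ × ℝ → ℝ, AnalyticAt ℝ g 0 ∧
        ∀ y ∈ e.source, MvPolynomial.eval (e y) φ = g (y 0, y 1)) ∧
    -- the normal forms when `φ (A x) = Q₁(x₁) + Q₂(x₁) x₂ + Q₃(x₁) x₃`; here
    -- `emultiplicity X Q` is the multiplicity of `0` as a root of `Q`, which is `⊤` for `Q = 0`
    (∀ (A : Matrix (Fin 3) (Fin 3) ℝ) (Q₁ Q₂ Q₃ : Polynomial ℝ), IsUnit A.det →
      (∀ x : Fin 3 → ℝ, MvPolynomial.eval (A.mulVec x) φ =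
        Q₁.eval (x 0) + Q₂.eval (x 0) * x 1 + Q₃.eval (x 0) * x 2) →
      (∀ ν₁ : ℕ, emultiplicity Polynomial.X Q₁ = ν₁ →
        (ν₁ : ℕ∞) ≤ emultiplicity Polynomial.X Q₂ →
        (ν₁ : ℕ∞) ≤ emultiplicity Polynomial.X Q₃ →
        ∃ e : OpenPartialHomeomorph (Fin 3 → ℝ) (Fin 3 → ℝ), IsLocalAnalyticChange e ∧
          ∀ y ∈ e.source, MvPolynomial.eval (A.mulVec (e y)) φ =
            Real.sign (Q₁.coeff ν₁) * y 0 ^ ν₁) ∧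
      (∀ ν₂ : ℕ, emultiplicity Polynomial.X Q₂ = ν₂ →
        (ν₂ : ℕ∞) < emultiplicity Polynomial.X Q₁ →
        (ν₂ : ℕ∞) ≤ emultiplicity Polynomial.X Q₃ →
        ∃ e : OpenPartialHomeomorph (Fin 3 → ℝ) (Fin 3 → ℝ), IsLocalAnalyticChange e ∧
          ∀ y ∈ e.source, MvPolynomial.eval (A.mulVec (e y)) φ = y 0 ^ ν₂ * y 1)) := by
  -- Over the infinite field `ℝ`, vanishing at every point is vanishing as a polynomial.
  have hdet : (hessianMatrix φ).det = 0 := MvPolynomial.funext fun x => by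
    rw [map_zero, RingHom.map_det]
    exact hhess x
  refine ⟨exists_two_variable_form hφ0 hgrad hdet, fun A Q₁ Q₂ Q₃ _ hQ => ⟨?_, ?_⟩⟩
  · intro ν h1 h2 h3
    exact exists_change_pow (ψ := fun x => MvPolynomial.eval (A.mulVec x) φ)
      (by simp only [Matrix.mulVec_zero, hφ0]) hQ h1 h2 h3
  · intro ν h2 h1 h3
    exact exists_change_pow_mul (ψ := fun x => MvPolynomial.eval (A.mulVec x) φ) hQ h2 h1 h3
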